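/- Let $p$ be a prime and let $\mathbb{P}^1(\mathbb{Q}_p)$ carry the spherical metric $$\rho([x_1:y_1],[x_2:y_2])=\frac{|x_1y_2-x_2y_1|_p}{\max\{|x_1|_p,|y_1|_p\}\,\max\{|x_2|_p,|y_2|_p\}}.$$ The degree of a rational function over a field is the maximum of the degrees of its numerator and denominator in lowest terms. Write $\phi\in\mathbb{Q}_p(z)$ as $\phi=f/g$ with $f,g\in\mathbb{Z}_p[z]$ having no common factors and at least one coefficient of $f$ or $g$ of absolute value $1$; $\phi$ has good reduction if the rational function $\overline{f}/\overline{g}$ over $\mathbb{F}_p$ (reduction of coefficients modulo $p$, common factors cancelled) has the same degree as $\phi$. A minimal component of $\phi$ is a nonempty clopen set $E\subset\mathbb{P}^1(\mathbb{Q}_p)$ that is a finite union of balls $\{x:\rho(x,a)\le p^{-n}\}$ ($n\ge 1$), satisfies $\phi(E)\subset E$, and in which the orbit under $\phi$ of every point of $E$ is dense. For a sequence $(p_s)_{s\ge1}$ of positive integers with $p_s\mid p_{s+1}$ for all $s$, the odometer $\mathbb{Z}_{(p_s)}$ with structure sequence $(p_s)$ is the inverse limit of the rings $\mathbb{Z}/p_s\mathbb{Z}$,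 with the inverse limit topology, and the adding machine on it is the map $z\mapsto z+1$. **Theorem.** Let $\phi\in\mathbb{Q}_p(z)$ be a rational map of degree at least $2$ with good reduction, and let $E\subset\mathbb{P}^1(\mathbb{Q}_p)$ be a minimal component of $\phi$. Then there are positive integers $k$ and $\ell$ with $1\le k\le p+1$ and $\ell\mid p-1$ such that $\phi|_E:E\to E$ is topologically conjugate to the adding machine on the odometer with structure sequence $$(k,\ k\ell,\ k\ell p,\ k\ell p^2,\ \dots).$$ -/

import Mathlib

open Polynomial

noncomputable section

namespace PadicGoodReduction

/-! ### The projective line and its spherical metric -/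

/-- The projective line over `ℚ_p`; the point `[x : y]` is the class of `![x, y]`. -/
abbrev P1 (p : ℕ) [Fact p.Prime] : Type := Projectivization ℚ_[p] (Fin 2 → ℚ_[p])

section Metric

variable {p : ℕ} [Fact p.Prime]

/-- The spherical distance in homogeneous coordinates. The norm on `Fin 2 → ℚ_[p]` is the
sup norm, so `‖v‖ = max (|v 0|_p) (|v 1|_p)`. -/
def coordDist (v w : Fin 2 → ℚ_[p]) : ℝ := ‖v 0 * w 1 - w 0 * v 1‖ / (‖v‖ * ‖w‖)

theorem coordDist_smul {a b : ℚ_[p]} (ha : a ≠ 0) (hb : b ≠ 0) (v w : Fin 2 → ℚ_[p]) :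
    coordDist (a • v) (b • w) = coordDist v w := by
  have ha' : ‖a‖ ≠ 0 := norm_ne_zero_iff.2 ha
  have hb' : ‖b‖ ≠ 0 := norm_ne_zero_iff.2 hb
  have h : (a • v) 0 * (b • w) 1 - (b • w) 0 * (a • v) 1
      = (a * b) * (v 0 * w 1 - w 0 * v 1) := by
    simp only [Pi.smul_apply, smul_eq_mul]; ring
  unfold coordDist
  rw [h, norm_smul, norm_smul, norm_mul, norm_mul,
    show ‖a‖ * ‖v‖ * (‖b‖ * ‖w‖) = (‖a‖ * ‖b‖) * (‖v‖ * ‖w‖) by ring]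
  exact mul_div_mul_left _ _ (mul_ne_zero ha' hb')

/-- The spherical metric `ρ` on `ℙ¹(ℚ_p)`. -/
def sphericalDist (P Q : P1 p) : ℝ := coordDist P.rep Q.rep

/-- The spherical metric can be computed with any choice of homogeneous coordinates. -/
theorem sphericalDist_mk (v w : Fin 2 → ℚ_[p]) (hv : v ≠ 0) (hw : w ≠ 0) :
    sphericalDist (Projectivization.mk ℚ_[p] v hv) (Projectivization.mk ℚ_[p] w hw)
      = coordDist v w := by
  obtain ⟨a, ha⟩ := Projectivization.exists_smul_eq_mk_rep ℚ_[p] v hv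
  obtain ⟨b, hb⟩ := Projectivization.exists_smul_eq_mk_rep ℚ_[p] w hw
  unfold sphericalDist
  rw [← ha, ← hb]
  exact coordDist_smul a.ne_zero b.ne_zero v w

theorem coordDist_ultra (u v w : Fin 2 → ℚ_[p]) (hu : u ≠ 0) (hv : v ≠ 0) (hw : w ≠ 0) :
    coordDist u w ≤ max (coordDist u v) (coordDist v w) := by
  have hu' : 0 < ‖u‖ := norm_pos_iff.2 hu
  have hv' : 0 < ‖v‖ := norm_pos_iff.2 hv
  have hw' : 0 < ‖w‖ := norm_pos_iff.2 hw
  set A := ‖u 0 * v 1 - v 0 * u 1‖ with hA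
  set B := ‖v 0 * w 1 - w 0 * v 1‖ with hB
  set C := ‖u 0 * w 1 - w 0 * u 1‖ with hC
  have key : C * ‖v‖ ≤ max (A * ‖w‖) (B * ‖u‖) := by
    rw [hC, ← norm_smul, pi_norm_le_iff_of_nonneg (by positivity)]
    have comp : ∀ i, ((u 0 * w 1 - w 0 * u 1) • v) i
        = (u 0 * v 1 - v 0 * u 1) * w i + (v 0 * w 1 - w 0 * v 1) * u i := by
      intro i
      fin_cases i <;> simp <;> ring
    intro i
    rw [comp i]
    refine (IsUltrametricDist.norm_add_le_max _ _).trans (max_le_max ?_ ?_)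
    · rw [norm_mul]; exact mul_le_mul_of_nonneg_left (norm_le_pi_norm w i) (norm_nonneg _)
    · rw [norm_mul]; exact mul_le_mul_of_nonneg_left (norm_le_pi_norm u i) (norm_nonneg _)
  have e1 : coordDist u w = C * ‖v‖ / (‖u‖ * ‖v‖ * ‖w‖) := by
    unfold coordDist; rw [← hC]; field_simp
  have e2 : coordDist u v = A * ‖w‖ / (‖u‖ * ‖v‖ * ‖w‖) := by
    unfold coordDist; rw [← hA]; field_simp
  have e3 : coordDist v w = B * ‖u‖ / (‖u‖ * ‖v‖ * ‖w‖) := by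
    unfold coordDist; rw [← hB]; field_simp
  have hD : 0 < ‖u‖ * ‖v‖ * ‖w‖ := by positivity
  rw [e1, e2, e3]
  rcases le_max_iff.1 key with h | h
  · exact le_max_of_le_left ((div_le_div_iff_of_pos_right hD).2 h)
  · exact le_max_of_le_right ((div_le_div_iff_of_pos_right hD).2 h)

theorem coordDist_nonneg (v w : Fin 2 → ℚ_[p]) : 0 ≤ coordDist v w := by
  unfold coordDist; positivity

theorem coordDist_eq_zero {v w : Fin 2 → ℚ_[p]} (hv : v ≠ 0) (hw : w ≠ 0)
    (h : coordDist v w = 0) : ∃ a : ℚ_[p], a • w = v := by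
  have h0 : v 0 * w 1 - w 0 * v 1 = 0 := by
    unfold coordDist at h
    rcases div_eq_zero_iff.1 h with h | h
    · exact norm_eq_zero.1 h
    · rcases mul_eq_zero.1 h with h | h
      · exact absurd (norm_eq_zero.1 h) hv
      · exact absurd (norm_eq_zero.1 h) hw
  by_cases h1 : w 1 = 0
  · have h2 : w 0 ≠ 0 := by
      intro h2; apply hw; ext i; fin_cases i <;> simp [h1, h2]
    have h3 : v 1 = 0 := by
      rw [h1] at h0; simpa [h2] using h0
    refine ⟨v 0 / w 0, ?_⟩
    ext i; fin_cases i <;> simp [h1, h2, h3]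
  · refine ⟨v 1 / w 1, ?_⟩
    ext i; fin_cases i
    · simp; field_simp; linear_combination -h0
    · simp [h1]

instance : MetricSpace (P1 p) where
  dist := sphericalDist
  dist_self P := by simp [sphericalDist, coordDist]
  dist_comm P Q := by
    change coordDist _ _ = coordDist _ _
    unfold coordDist
    rw [norm_sub_rev, mul_comm ‖P.rep‖]
  dist_triangle P Q R := by
    change coordDist _ _ ≤ coordDist _ _ + coordDist _ _
    exact (coordDist_ultra _ Q.rep _ P.rep_nonzero Q.rep_nonzero R.rep_nonzero).trans
      (max_le_add_of_nonneg (coordDist_nonneg _ _) (coordDist_nonneg _ _))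
  eq_of_dist_eq_zero {P Q} h := by
    rw [← P.mk_rep, ← Q.mk_rep, Projectivization.mk_eq_mk_iff']
    exact coordDist_eq_zero P.rep_nonzero Q.rep_nonzero h

/-- The ball `B_n(a) = {x : ρ(x, a) ≤ p^{-n}}`. -/
def ball (a : P1 p) (n : ℕ) : Set (P1 p) := {x | dist x a ≤ ((p : ℝ) ^ n)⁻¹}

end Metric

/-! ### Rational maps -/

section RationalMaps

variable {K : Type*} [Field K]

/-- The degree of a rational map: the maximum of the degrees of the numerator and the
denominator in lowest terms. -/
def ratDegree (φ : RatFunc K) : ℕ := max φ.num.natDegree φ.denom.natDegree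

/-- The homogenization of degree `d` of `f`, evaluated at `v`:
`∑_{i ≤ d} a_i x^i y^(d-i)` for `v = (x, y)`. -/
def homEval (f : K[X]) (d : ℕ) (v : Fin 2 → K) : K :=
  ∑ i ∈ Finset.range (d + 1), f.coeff i * v 0 ^ i * v 1 ^ (d - i)

theorem homEval_smul (f : K[X]) (d : ℕ) (t : K) (v : Fin 2 → K) :
    homEval f d (t • v) = t ^ d * homEval f d v := by
  unfold homEval
  rw [Finset.mul_sum]
  refine Finset.sum_congr rfl fun i hi => ?_
  have hi' : i + (d - i) = d := by have := Finset.mem_range.1 hi; omega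
  simp only [Pi.smul_apply, smul_eq_mul, mul_pow]
  calc f.coeff i * (t ^ i * v 0 ^ i) * (t ^ (d - i) * v 1 ^ (d - i))
      = t ^ (i + (d - i)) * (f.coeff i * v 0 ^ i * v 1 ^ (d - i)) := by rw [pow_add]; ring
    _ = _ := by rw [hi']

theorem homEval_of_ne_zero (f : K[X]) (d : ℕ) (hd : f.natDegree ≤ d) (v : Fin 2 → K)
    (hv : v 1 ≠ 0) : homEval f d v = v 1 ^ d * f.eval (v 0 / v 1) := by
  unfold homEval
  rw [Polynomial.eval_eq_sum_range' (Nat.lt_succ_of_le hd), Finset.mul_sum]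
  refine Finset.sum_congr rfl fun i hi => ?_
  have hi' : v 1 ^ d = v 1 ^ i * v 1 ^ (d - i) := by
    rw [← pow_add]; congr 1; have := Finset.mem_range.1 hi; omega
  rw [hi', div_pow]
  field_simp

theorem homEval_of_eq_zero (f : K[X]) (d : ℕ) (v : Fin 2 → K)
    (hv : v 1 = 0) : homEval f d v = f.coeff d * v 0 ^ d := by
  unfold homEval
  rw [Finset.sum_range_succ, Finset.sum_eq_zero]
  · simp
  · intro i hi
    have : d - i ≠ 0 := by have := Finset.mem_range.1 hi; omega
    simp [hv, this]

/-- The homogeneous lift `(F, G)` of the rational map `φ`. -/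
def homLift (φ : RatFunc K) (v : Fin 2 → K) : Fin 2 → K :=
  ![homEval φ.num (ratDegree φ) v, homEval φ.denom (ratDegree φ) v]

theorem homLift_smul (φ : RatFunc K) (t : K) (v : Fin 2 → K) :
    homLift φ (t • v) = t ^ ratDegree φ • homLift φ v := by
  ext i
  fin_cases i <;> simp [homLift, homEval_smul]

theorem homLift_ne_zero (φ : RatFunc K) {v : Fin 2 → K} (hv : v ≠ 0) : homLift φ v ≠ 0 := by
  intro h
  have hF : homEval φ.num (ratDegree φ) v = 0 := by simpa [homLift] using congrFun h 0
  have hG : homEval φ.denom (ratDegree φ) v = 0 := by simpa [homLift] using congrFun h 1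
  by_cases h1 : v 1 = 0
  · have h0 : v 0 ≠ 0 := by
      intro h0; apply hv; ext i; fin_cases i <;> simp [h0, h1]
    rw [homEval_of_eq_zero _ _ _ h1] at hF hG
    have hF' : φ.num.coeff (ratDegree φ) = 0 := by simpa [h0] using hF
    have hG' : φ.denom.coeff (ratDegree φ) = 0 := by simpa [h0] using hG
    rcases le_total φ.num.natDegree φ.denom.natDegree with hle | hle
    · rw [ratDegree, max_eq_right hle, Polynomial.coeff_natDegree] at hG'
      exact φ.denom_ne_zero (Polynomial.leadingCoeff_eq_zero.1 hG')
    · rw [ratDegree, max_eq_left hle, Polynomial.coeff_natDegree] at hF'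
      have hn : φ.num = 0 := Polynomial.leadingCoeff_eq_zero.1 hF'
      have hd : φ.denom.natDegree = 0 := by simpa [hn] using hle
      rw [ratDegree, max_eq_left hle, hn, Polynomial.natDegree_zero, ← hd,
        Polynomial.coeff_natDegree] at hG'
      exact φ.denom_ne_zero (Polynomial.leadingCoeff_eq_zero.1 hG')
  · rw [homEval_of_ne_zero _ (ratDegree φ) (le_max_left _ _) _ h1] at hF
    rw [homEval_of_ne_zero _ (ratDegree φ) (le_max_right _ _) _ h1] at hG
    have hF' : φ.num.eval (v 0 / v 1) = 0 := by simpa [h1] using hF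
    have hG' : φ.denom.eval (v 0 / v 1) = 0 := by simpa [h1] using hG
    obtain ⟨a, b, hab⟩ := φ.isCoprime_num_denom
    have := congrArg (Polynomial.eval (v 0 / v 1)) hab
    simp [hF', hG'] at this

/-- The transformation of the projective line induced by the rational map `φ`:
`[x : y] ↦ [F(x, y) : G(x, y)]`. -/
def ratMap (φ : RatFunc K) :
    Projectivization K (Fin 2 → K) → Projectivization K (Fin 2 → K) :=
  Projectivization.lift
    (fun v => Projectivization.mk K (homLift φ v.1) (homLift_ne_zero φ v.2))
    (fun a b t h => by
      rw [Projectivization.mk_eq_mk_iff']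
      exact ⟨t ^ ratDegree φ, by rw [h, homLift_smul]⟩)

end RationalMaps

/-- Good reduction: `φ` is written as `f / g` with `f, g ∈ ℤ_p[z]` having no common factors and
at least one coefficient of `f` or `g` of absolute value `1`, and the reduced rational
function `f̄ / ḡ ∈ 𝔽_p(z)` has the same degree as `φ`. If `ḡ = 0` the reduction is the constant
`∞`, of degree `0`; the quotient `f̄ / 0 = 0` has the same degree. -/
def HasGoodReduction {p : ℕ} [Fact p.Prime] (φ : RatFunc ℚ_[p]) : Prop :=
  ∃ f g : ℤ_[p][X], g ≠ 0 ∧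
    IsCoprime (f.map PadicInt.Coe.ringHom) (g.map PadicInt.Coe.ringHom) ∧
    (∃ i, ‖f.coeff i‖ = 1 ∨ ‖g.coeff i‖ = 1) ∧
    φ = algebraMap ℚ_[p][X] (RatFunc ℚ_[p]) (f.map PadicInt.Coe.ringHom) /
        algebraMap ℚ_[p][X] (RatFunc ℚ_[p]) (g.map PadicInt.Coe.ringHom) ∧
    ratDegree (algebraMap (ZMod p)[X] (RatFunc (ZMod p)) (f.map PadicInt.toZMod) /
        algebraMap (ZMod p)[X] (RatFunc (ZMod p)) (g.map PadicInt.toZMod)) = ratDegree φ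

/-! ### Minimal components -/

/-- `E` is a nonempty clopen set, a finite union of balls, invariant under `φ`, and every orbit
in `E` is dense in `E`. -/
structure IsMinimalComponent {p : ℕ} [Fact p.Prime] (φ : RatFunc ℚ_[p]) (E : Set (P1 p)) :
    Prop where
  nonempty : E.Nonempty
  isClopen : IsClopen E
  finite_union_balls : ∃ T : Finset (P1 p × ℕ), (∀ t ∈ T, 1 ≤ t.2) ∧ E = ⋃ t ∈ T, ball t.1 t.2
  mapsTo : Set.MapsTo (ratMap φ) E E
  dense_orbit : ∀ x ∈ E, E ⊆ closure (Set.range fun n : ℕ => (ratMap φ)^[n] x)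

/-! ### Odometers -/

/-- The odometer with structure sequence `s`: the inverse limit of the rings `ℤ/(s n)ℤ`,
with the topology induced by the product of the discrete topologies. -/
def odometer (s : ℕ → ℕ) (hs : ∀ n, s n ∣ s (n + 1)) : Subring (∀ n, ZMod (s n)) where
  carrier := {x | ∀ n, ZMod.castHom (hs n) (ZMod (s n)) (x (n + 1)) = x n}
  mul_mem' ha hb n := by rw [Pi.mul_apply, map_mul, ha n, hb n, Pi.mul_apply]
  one_mem' n := by rw [Pi.one_apply, map_one, Pi.one_apply]
  add_mem' ha hb n := by rw [Pi.add_apply, map_add, ha n, hb n, Pi.add_apply]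
  zero_mem' n := by rw [Pi.zero_apply, map_zero, Pi.zero_apply]
  neg_mem' ha n := by rw [Pi.neg_apply, map_neg, ha n, Pi.neg_apply]

/-- The adding machine `z ↦ z + 1`. -/
def addingMachine (s : ℕ → ℕ) (hs : ∀ n, s n ∣ s (n + 1)) (z : odometer s hs) :
    odometer s hs := z + 1

/-- The sequence `(k, kℓ, kℓp, kℓp², …)`. -/
def structureSeq (p k l : ℕ) : ℕ → ℕ
  | 0 => k
  | n + 1 => k * l * p ^ n

theorem structureSeq_dvd (p k l : ℕ) : ∀ n, structureSeq p k l n ∣ structureSeq p k l (n + 1)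
  | 0 => ⟨l, by simp [structureSeq]⟩
  | n + 1 => ⟨p, by simp [structureSeq, pow_succ, mul_assoc]⟩

/-- Topological conjugacy of dynamical systems. -/
def TopConjugate {X Y : Type*} [TopologicalSpace X] [TopologicalSpace Y]
    (f : X → X) (g : Y → Y) : Prop :=
  ∃ h : X ≃ₜ Y, Function.Semiconj h f g

end PadicGoodReduction

end

namespace PadicGoodReduction

/-! ### Return times -/

/-! Good reduction makes `φ` nonexpanding for `ρ` and affine to first order on residue discs: near a
point, a coordinate displacement divisible by `p^n` is multiplied by a fixed scalar modulo `p^(n+1)`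
(`exists_multiplier`, `dist_ratMap_le`). Fix `x` in `E`. Being within `p⁻ⁿ` is an equivalence
relation on orbit times that survives adding a constant, hence is congruence modulo some `s n`
(`exists_returnTime`). So time modulo `s n` encodes position up to `p⁻ⁿ`, and by compactness `φ` on
`E` is the adding machine for `s`, or for any sequence cofinal with `s` under divisibility
(`topConjugate_addingMachine`).

It remains to compute `s`. The orbit visits `k = s 1` of the `p + 1` residue discs. Let `β` be the
product modulo `p` of the multipliers over the first `k` steps. On the next digit, `φ^(s n)` acts as
`y ↦ λy + a` on `ZMod p` with `λ = β^(s n / k)`, so `s (n+1) / s n` is the least positive time at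
which the orbit of `0` returns to `0`: it is `1` if `a = 0`, otherwise `p` if `λ = 1` and the order
of `λ` if `λ ≠ 0, 1`. Openness of `E` forces growth at all late levels, which excludes `β = 0`. The
first growth factor is `ℓ = orderOf β` (or `p` when `β = 1`); from then on `λ = 1` and every growth
factor is `p` (`exists_structureSeq_cofinal`). -/

/-- A translation-invariant equivalence relation on `ℕ` relating some positive number to `0` is
congruence modulo a positive integer. -/
theorem exists_modulus_of_equivalence {R : ℕ → ℕ → Prop} (hR : Equivalence R)
    (hadd : ∀ a b c, R a b → R (a + c) (b + c)) (hpos : ∃ m, 0 < m ∧ R m 0) :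
    ∃ s, 0 < s ∧ ∀ a b, R a b ↔ a ≡ b [MOD s] := by
  classical
  set s := Nat.find hpos with hs
  obtain ⟨hs0, hsR⟩ := Nat.find_spec hpos
  rw [← hs] at hs0 hsR
  have hmin : ∀ m, 0 < m → R m 0 → s ≤ m := fun m h0 h => Nat.find_min' hpos ⟨h0, h⟩
  have hmul : ∀ k r, R (r + s * k) r := by
    intro k r
    induction k with
    | zero => simpa using hR.refl r
    | succ k ih =>
      have := hadd _ _ (r + s * k) hsR
      rw [show s + (r + s * k) = r + s * (k + 1) by ring, zero_add] at this
      exact hR.trans this ih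
  have hmod : ∀ a, R a (a % s) := fun a => by
    simpa [Nat.mod_add_div] using hmul (a / s) (a % s)
  -- Shifting a relation between `i < j` by `s - j` relates `i + s - j` to `s`, hence to `0`,
  -- against the minimality of `s`.
  have hlt : ∀ i j, i < s → j < s → i < j → ¬ R i j := by
    intro i j _ hj hij h
    have h1 := hadd _ _ (s - j) h
    rw [show j + (s - j) = s by omega] at h1
    have := hmin _ (by omega) (hR.trans h1 hsR)
    omega
  refine ⟨s, hs0, fun a b => ⟨fun h => ?_, fun h => ?_⟩⟩
  · have h1 : R (a % s) (b % s) := hR.trans (hR.symm (hmod a)) (hR.trans h (hmod b))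
    have ha := Nat.mod_lt a hs0
    have hb := Nat.mod_lt b hs0
    rcases lt_trichotomy (a % s) (b % s) with h2 | h2 | h2
    · exact absurd h1 (hlt _ _ ha hb h2)
    · exact h2
    · exact absurd (hR.symm h1) (hlt _ _ hb ha h2)
  · have h1 := hmod a
    rw [show a % s = b % s from h] at h1
    exact hR.trans h1 (hR.symm (hmod b))

theorem dist_iterate_le {X : Type*} [MetricSpace X] {T : X → X}
    (hT : ∀ x y, dist (T x) (T y) ≤ dist x y) (n : ℕ) (x y : X) :
    dist (T^[n] x) (T^[n] y) ≤ dist x y := by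
  induction n with
  | zero => simp
  | succ n ih =>
    rw [Function.iterate_succ_apply', Function.iterate_succ_apply']
    exact (hT _ _).trans ih

section Conjugacy

variable {X : Type*} [MetricSpace X] [IsUltrametricDist X] {T : X → X}

/-- For a 1-Lipschitz map of an ultrametric space, returning `ε`-close to a recurrent point is
governed by a congruence. -/
theorem exists_returnTime (hT : ∀ x y, dist (T x) (T y) ≤ dist x y) (x : X) {ε : ℝ} (hε : 0 ≤ ε)
    (hrec : ∃ m, 0 < m ∧ dist (T^[m] x) x ≤ ε) :
    ∃ s, 0 < s ∧ ∀ a b, dist (T^[a] x) (T^[b] x) ≤ ε ↔ a ≡ b [MOD s] := by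
  refine exists_modulus_of_equivalence (R := fun a b => dist (T^[a] x) (T^[b] x) ≤ ε)
    ⟨fun a => by simpa using hε, fun {a b} h => by rwa [dist_comm], fun {a b c} h1 h2 => ?_⟩
    (fun a b c h => ?_) hrec
  · exact (dist_triangle_max _ _ _).trans (max_le h1 h2)
  · rw [add_comm a, add_comm b, Function.iterate_add_apply, Function.iterate_add_apply]
    exact (dist_iterate_le hT _ _ _).trans h

/-! ### Conjugacy with an odometer -/

/-- A 1-Lipschitz map of a compact ultrametric space with a dense orbit whose return times are
cofinal with `t` is conjugate to the adding machine with structure sequence `t`. -/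
theorem topConjugate_addingMachine [CompactSpace X] (hT : ∀ x y, dist (T x) (T y) ≤ dist x y)
    {x₀ : X} (hdense : DenseRange fun n : ℕ => T^[n] x₀) {ε : ℕ → ℝ} (hε0 : ∀ n, 0 < ε n)
    (hanti : Antitone ε) (hεlim : ∀ δ > 0, ∃ n, ε n < δ) {s : ℕ → ℕ} (hs0 : ∀ n, 0 < s n)
    (hs : ∀ n a b, dist (T^[a] x₀) (T^[b] x₀) ≤ ε n ↔ a ≡ b [MOD s n])
    (t : ℕ → ℕ) (ht : ∀ n, t n ∣ t (n + 1)) (hts : ∀ n, ∃ m, t n ∣ s m)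
    (hst : ∀ m, ∃ n, s m ∣ t n) : TopConjugate T (addingMachine t ht) := by
  have hsmono : ∀ {m n}, m ≤ n → s m ∣ s n := fun {m n} hmn => by
    have h : dist (T^[s n] x₀) (T^[0] x₀) ≤ ε n := (hs n _ _).2 (by simp [Nat.ModEq])
    exact (Nat.modEq_zero_iff_dvd).1 ((hs m _ _).1 (h.trans (hanti hmn)))
  have htmono : ∀ {m n}, m ≤ n → t m ∣ t n := fun {m n} hmn =>
    Nat.le_induction dvd_rfl (fun k _ h => h.trans (ht k)) n hmn
  -- Besides `t n ∣ s (N n)`, the bound `n ≤ N n` makes the radii `ε (N n)` shrink, which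
  -- injectivity needs.
  have hN : ∀ n, ∃ m, n ≤ m ∧ t n ∣ s m := fun n => by
    obtain ⟨m, hm⟩ := hts n
    exact ⟨max n m, le_max_left _ _, hm.trans (hsmono (le_max_right _ _))⟩
  choose N hNn hNt using hN
  have ht0 : ∀ n, NeZero (t n) := fun n => ⟨fun h => (hs0 (N n)).ne'
    (Nat.eq_zero_of_zero_dvd (h ▸ hNt n))⟩
  have happ : ∀ x n, ∃ a : ℕ, dist (T^[a] x₀) x ≤ ε n := fun x n => by
    obtain ⟨a, ha⟩ := hdense.exists_dist_lt x (hε0 n)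
    exact ⟨a, by rw [dist_comm]; exact ha.le⟩
  choose A hA using happ
  have hcongr : ∀ n x a, dist (T^[a] x₀) x ≤ ε (N n) → (A x (N n) : ZMod (t n)) = a := by
    intro n x a h
    rw [ZMod.natCast_eq_natCast_iff]
    refine Nat.ModEq.of_dvd (hNt n) ((hs _ _ _).1 ?_)
    refine (dist_triangle_max _ x _).trans (max_le (hA _ _) ?_)
    rwa [dist_comm]
  -- `N` need not be monotone, so the two approximations are compared at the coarser of the two
  -- radii.
  have hle : ∀ n x a m, n ≤ m → dist (T^[a] x₀) x ≤ ε (N m) →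
      (A x (N n) : ZMod (t n)) = a := by
    intro n x a m hnm h
    have h1 : dist (T^[a] x₀) (T^[A x (N n)] x₀) ≤ ε (min (N n) (N m)) := by
      refine (dist_triangle_max _ x _).trans (max_le (h.trans (hanti (min_le_right _ _))) ?_)
      rw [dist_comm]
      exact (hA _ _).trans (hanti (min_le_left _ _))
    rw [ZMod.natCast_eq_natCast_iff]
    refine (Nat.ModEq.of_dvd ?_ ((hs _ _ _).1 h1)).symm
    rcases le_total (N n) (N m) with h2 | h2
    · rw [min_eq_left h2]; exact hNt n
    · rw [min_eq_right h2]; exact (htmono hnm).trans (hNt m)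
  let H : X → odometer t ht := fun x => ⟨fun n => (A x (N n) : ZMod (t n)), fun n => by
    rw [map_natCast]
    exact (hle n x _ (n + 1) n.le_succ (hA x _)).symm⟩
  have hH : ∀ n x a, dist (T^[a] x₀) x ≤ ε (N n) → (H x).1 n = a := hcongr
  have hcont : Continuous H := by
    refine Continuous.subtype_mk (continuous_pi fun n => ?_) _
    rw [continuous_iff_continuousAt]
    intro x
    refine ContinuousAt.congr (f := fun _ => (A x (N n) : ZMod (t n))) continuousAt_const ?_
    filter_upwards [Metric.closedBall_mem_nhds x (hε0 (N n))] with y hy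
    refine (hcongr n y _ ?_).symm
    exact (dist_triangle_max _ x _).trans (max_le (hA _ _) (by rw [dist_comm]; exact hy))
  have hinj : Function.Injective H := by
    intro x y hxy
    refine dist_le_zero.1 (le_of_forall_pos_lt_add fun δ hδ => ?_)
    obtain ⟨m, hm⟩ := hεlim δ hδ
    obtain ⟨n, hn⟩ := hst m
    set n' := max m n
    have h1 : (A x (N n') : ZMod (t n')) = A y (N n') := congrFun (congrArg Subtype.val hxy) n'
    rw [ZMod.natCast_eq_natCast_iff] at h1
    have h2 := (hs m _ _).2 (h1.of_dvd (hn.trans (htmono (le_max_right _ _))))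
    have h3 : ε (N n') ≤ ε m := hanti ((le_max_left _ _).trans (hNn n'))
    have h4 : dist x y ≤ ε m := by
      refine (dist_triangle_max _ (T^[A x (N n')] x₀) _).trans (max_le ?_ ?_)
      · rw [dist_comm]; exact (hA _ _).trans h3
      · exact (dist_triangle_max _ _ _).trans (max_le h2 ((hA _ _).trans h3))
    linarith
  -- The sets of points with the right `n`-th coordinate are nested, compact, and nonempty because
  -- each contains an orbit point.
  have hsurj : Function.Surjective H := by
    intro z
    have hcl : ∀ n, IsClosed {x | (H x).1 n = z.1 n} := fun n =>
      isClosed_eq ((continuous_apply n).comp (continuous_subtype_val.comp hcont)) continuous_const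
    obtain ⟨x, hx⟩ := IsCompact.nonempty_iInter_of_sequence_nonempty_isCompact_isClosed
      (fun n => {x | (H x).1 n = z.1 n})
      (fun n x hx => by
        have hx' : (H x).1 (n + 1) = z.1 (n + 1) := hx
        change (H x).1 n = z.1 n
        rw [← (H x).2 n, ← z.2 n, hx'])
      (fun n => by
        obtain ⟨a, ha⟩ := ZMod.natCast_zmod_surjective (z.1 n)
        exact ⟨T^[a] x₀, (hH n _ a (by simpa using (hε0 _).le)).trans ha⟩)
      (hcl 0).isCompact hcl
    exact ⟨x, Subtype.ext (funext fun n => Set.mem_iInter.1 hx n)⟩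
  refine ⟨hcont.homeoOfEquivCompactToT2 (f := Equiv.ofBijective H ⟨hinj, hsurj⟩), fun x => ?_⟩
  refine Subtype.ext (funext fun n => ?_)
  have h1 : (H (T x)).1 n = ((A x (N n) + 1 : ℕ) : ZMod (t n)) := by
    refine hH n _ _ ?_
    rw [Function.iterate_succ_apply']
    exact (hT _ _).trans (hA _ _)
  refine h1.trans ?_
  rw [Nat.cast_add, Nat.cast_one]
  rfl

end Conjugacy

/-! ### Growth of the return times -/

/-- If the growth of `s` from each level to the next is governed by an affine map of `ZMod p` with
linear part a power of `β`, then `s` is cofinal with `structureSeq p (s 1) (orderOf β)`. -/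
theorem exists_structureSeq_cofinal {p : ℕ} [hp : Fact p.Prime] {s : ℕ → ℕ} (hs0 : ∀ n, 0 < s n)
    (hdvd : ∀ n, s n ∣ s (n + 1)) (β : ZMod p) (a : ℕ → ZMod p)
    (haff : ∀ n, 1 ≤ n → ∀ j,
      s (n + 1) ∣ s n * j ↔ a n * ∑ i ∈ Finset.range j, (β ^ (s n / s 1)) ^ i = 0)
    (hgrow : ∃ N, ∀ n, N ≤ n → s (n + 1) ≠ s n) :
    ∃ l, l ∣ p - 1 ∧ (∀ n, ∃ m, structureSeq p (s 1) l n ∣ s m) ∧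
      ∀ m, ∃ n, s m ∣ structureSeq p (s 1) l n := by
  have hmono : ∀ {m n}, m ≤ n → s m ∣ s n := fun {m n} hmn =>
    Nat.le_induction dvd_rfl (fun k _ h => h.trans (hdvd k)) n hmn
  obtain ⟨N, hN⟩ := hgrow
  have ha : ∀ n, 1 ≤ n → a n = 0 → s (n + 1) = s n := fun n hn h0 => by
    have := (haff n hn 1).2 (by simp [h0])
    rw [mul_one] at this
    exact Nat.dvd_antisymm this (hdvd n)
  -- For `β = 0` the geometric sum is `1` for every `j > 0`, so any return forces `a n = 0` and
  -- growth stops. Taking `n = N + 1` ensures `n ≥ 1`.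
  have hβ : β ≠ 0 := by
    rintro rfl
    set n := N + 1
    obtain ⟨j, hj⟩ := hdvd n
    have hq : s n / s 1 ≠ 0 :=
      (Nat.div_pos (Nat.le_of_dvd (hs0 n) (hmono (by omega))) (hs0 1)).ne'
    have hj0 : j ≠ 0 := by rintro rfl; exact (hs0 (n + 1)).ne' (by simpa using hj)
    have h1 := (haff n (by omega) j).1 (by rw [hj])
    obtain ⟨j, rfl⟩ := Nat.exists_eq_succ_of_ne_zero hj0
    rw [zero_pow hq, Finset.sum_range_succ'] at h1
    exact hN n (by omega) (ha n (by omega) (by simpa using h1))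
  have hl : orderOf β ∣ p - 1 := orderOf_dvd_of_pow_eq_one (ZMod.pow_card_sub_one_eq_one hβ)
  -- With `a n ≠ 0`, the sum is `j` if the ratio is `1`, and otherwise vanishes exactly when the
  -- `j`-th power of the ratio is `1`.
  have hratio : ∀ n, 1 ≤ n → s (n + 1) = s n ∨
      s (n + 1) = s n * (if β ^ (s n / s 1) = 1 then p else orderOf (β ^ (s n / s 1))) := by
    intro n hn
    by_cases h0 : a n = 0
    · exact Or.inl (ha n hn h0)
    right
    obtain ⟨r, hr⟩ := hdvd n
    rw [hr]
    congr 1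
    have key : ∀ j, r ∣ j ↔ ∑ i ∈ Finset.range j, (β ^ (s n / s 1)) ^ i = 0 := fun j => by
      rw [← Nat.mul_dvd_mul_iff_left (hs0 n), ← hr, haff n hn j, mul_eq_zero, or_iff_right h0]
    refine Nat.dvd_right_iff_eq.1 fun j => ?_
    rw [key]
    split_ifs with h1
    · simp [h1, ZMod.natCast_eq_zero_iff]
    · rw [geom_sum_eq h1, div_eq_zero_iff, or_iff_left (sub_ne_zero.2 h1), sub_eq_zero,
        orderOf_dvd_iff_pow_eq_one]
  have hshape : ∀ n, s (n + 1) = s 1 ∨ ∃ j, s (n + 1) = s 1 * orderOf β * p ^ j := by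
    intro n
    induction n with
    | zero => exact Or.inl rfl
    | succ n ih =>
      rcases hratio (n + 1) (by omega) with h | h
      · rwa [h]
      rcases ih with ih | ⟨j, ih⟩
      · rw [ih, Nat.div_self (hs0 1), pow_one] at h
        split_ifs at h with h1
        -- If `β = 1` then `ℓ = 1`, and the first growth already contributes a factor `p`.
        · exact Or.inr ⟨1, by rw [h, h1, orderOf_one, mul_one, pow_one]⟩
        · exact Or.inr ⟨0, by rw [h, pow_zero, mul_one]⟩
      · have h1 : β ^ (s (n + 1) / s 1) = 1 := by
          rw [ih, mul_assoc, Nat.mul_div_cancel_left _ (hs0 1), pow_mul, pow_orderOf_eq_one,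
            one_pow]
        rw [if_pos h1, ih] at h
        exact Or.inr ⟨j + 1, by rw [h, pow_succ, mul_assoc]⟩
  have hunb : ∀ K, ∃ n, K < s (n + 1) := by
    have hlt : StrictMono fun i => s (N + i + 1) := strictMono_nat_of_lt_succ fun i => by
      refine lt_of_le_of_ne (Nat.le_of_dvd (hs0 _) (hdvd _)) (hN (N + i + 1) (by omega)).symm
    exact fun K => ⟨N + (K + 1), hlt.le_apply.trans' (Nat.lt_succ_self K)⟩
  refine ⟨orderOf β, hl, fun n => ?_, fun m => ?_⟩
  -- Exceeding `k ℓ p^n` rules out the initial value `k` and forces the exponent of `p` above `n`.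
  · obtain ⟨i, hi⟩ := hunb (s 1 * (orderOf β * p ^ n))
    have hl0 : 0 < orderOf β := orderOf_pos_iff.2 (isOfFinOrder_iff_pow_eq_one.2
      ⟨p - 1, by have := hp.out.two_le; omega, ZMod.pow_card_sub_one_eq_one hβ⟩)
    refine ⟨i + 1, ?_⟩
    rcases hshape i with h | ⟨j, h⟩
    · have : 0 < orderOf β * p ^ n := Nat.mul_pos hl0 (pow_pos hp.out.pos n)
      have := Nat.le_mul_of_pos_right (s 1) this
      omega
    · have hj : n < j := by
        rw [h, mul_assoc] at hi
        exact (Nat.pow_lt_pow_iff_right hp.out.one_lt).1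
          (lt_of_mul_lt_mul_left (lt_of_mul_lt_mul_left hi (Nat.zero_le _)) (Nat.zero_le _))
      rw [h]
      cases n with
      | zero => exact Dvd.intro _ (mul_assoc _ _ _).symm
      | succ n => exact Nat.mul_dvd_mul_left _ (pow_dvd_pow p (by omega))
  · have h1 : s m ∣ s (m + 1) := hdvd m
    rcases hshape m with h | ⟨j, h⟩
    · exact ⟨0, by rwa [h] at h1⟩
    · exact ⟨j + 1, by rwa [h] at h1⟩

section Charts

variable {p : ℕ} [hp : Fact p.Prime]

/-! ### Charts of the projective line -/

instance : IsUltrametricDist (P1 p) where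
  dist_triangle_max P Q R :=
    coordDist_ultra _ _ _ P.rep_nonzero Q.rep_nonzero R.rep_nonzero

/-- Homogeneous coordinates of the point with coordinate `z` in one of the two standard charts. -/
def chartVec {R : Type*} [One R] (b : Bool) (z : R) : Fin 2 → R := bif b then ![1, z] else ![z, 1]

theorem chartVec_ne_zero {R : Type*} [Semiring R] [Nontrivial R] (b : Bool) (z : R) :
    chartVec b z ≠ 0 := by
  intro h
  cases b
  · simpa [chartVec] using congrFun h 1
  · simpa [chartVec] using congrFun h 0

theorem norm_chartVec (b : Bool) (z : ℤ_[p]) : ‖chartVec b (z : ℚ_[p])‖ = 1 := by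
  refine le_antisymm ((pi_norm_le_iff_of_nonneg zero_le_one).2 fun i => ?_) ?_
  · cases b <;> fin_cases i <;> simp [chartVec, PadicInt.norm_le_one]
  · cases b
    · simpa [chartVec] using norm_le_pi_norm (chartVec false (z : ℚ_[p])) 1
    · simpa [chartVec] using norm_le_pi_norm (chartVec true (z : ℚ_[p])) 0

/-- The point `[z : 1]` or `[1 : z]`. -/
noncomputable def chart (b : Bool) (z : ℤ_[p]) : P1 p :=
  Projectivization.mk ℚ_[p] (chartVec b (z : ℚ_[p])) (chartVec_ne_zero b _)

theorem dist_chart (b : Bool) (z w : ℤ_[p]) : dist (chart b z) (chart b w) = ‖z - w‖ := by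
  change sphericalDist _ _ = _
  rw [chart, chart, sphericalDist_mk, coordDist, norm_chartVec, norm_chartVec, mul_one, div_one,
    ← PadicInt.padic_norm_e_of_padicInt, PadicInt.coe_sub]
  cases b
  · simp [chartVec]
  · simp [chartVec, norm_sub_rev (w : ℚ_[p])]

/-- Confining the chart at infinity to the open unit disc makes `z * w` small, so `z * w - 1` is a
unit. Thus the two charts partition the line into sets at mutual distance `1`. -/
theorem dist_chart_of_ne {b b' : Bool} (hb : b ≠ b') {z w : ℤ_[p]} (hz : b = true → ‖z‖ < 1)
    (hw : b' = true → ‖w‖ < 1) : dist (chart b z) (chart b' w) = 1 := by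
  have key : ∀ z w : ℤ_[p], ‖w‖ < 1 → dist (chart false z) (chart true w) = 1 := by
    intro z w hw
    have h1 : ‖(z * w : ℚ_[p])‖ < 1 := by
      rw [norm_mul]
      exact mul_lt_one_of_nonneg_of_lt_one_right (PadicInt.norm_le_one z) (norm_nonneg _) hw
    change sphericalDist _ _ = _
    rw [chart, chart, sphericalDist_mk, coordDist, norm_chartVec, norm_chartVec, mul_one, div_one]
    have h2 := IsUltrametricDist.norm_add_eq_max_of_norm_ne_norm
      (x := (z * w : ℚ_[p])) (y := -1) (by rw [norm_neg, norm_one]; exact h1.ne)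
    rw [norm_neg, norm_one, max_eq_right h1.le] at h2
    simpa [chartVec, sub_eq_add_neg] using h2
  cases b <;> cases b'
  · exact absurd rfl hb
  · exact key z w (hw rfl)
  · rw [dist_comm]; exact key w z (hz rfl)
  · exact absurd rfl hb

theorem mk_eq_chart {v : Fin 2 → ℚ_[p]} (hv : v ≠ 0) {b : Bool} {z : ℤ_[p]} {c : ℚ_[p]}
    (h : c • chartVec b (z : ℚ_[p]) = v) : Projectivization.mk ℚ_[p] v hv = chart b z :=
  (Projectivization.mk_eq_mk_iff' _ _ _ _ _).2 ⟨c, h⟩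

theorem exists_chart (P : P1 p) : ∃ b z, chart b z = P ∧ (b = true → ‖z‖ < 1) := by
  have hv := P.rep_nonzero
  set v := P.rep with hvdef
  have hP : Projectivization.mk ℚ_[p] v hv = P := P.mk_rep
  rcases le_or_gt ‖v 0‖ ‖v 1‖ with h | h
  · have h1 : v 1 ≠ 0 := by
      intro h1
      rw [h1, norm_zero, norm_le_zero_iff] at h
      exact hv (by ext i; fin_cases i <;> simp [h, h1])
    refine ⟨false, ⟨v 0 / v 1, by rw [norm_div]; exact div_le_one_of_le₀ h (norm_nonneg _)⟩, ?_,
      by simp⟩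
    rw [← hP]
    refine (mk_eq_chart hv (c := v 1) ?_).symm
    ext i; fin_cases i <;> simp [chartVec, mul_div_cancel₀ _ h1]
  · have h1 : v 0 ≠ 0 := norm_pos_iff.1 ((norm_nonneg _).trans_lt h)
    have h2 : ‖v 1 / v 0‖ < 1 := by
      rw [norm_div]; exact (div_lt_one (norm_pos_iff.2 h1)).2 h
    refine ⟨true, ⟨v 1 / v 0, h2.le⟩, ?_, fun _ => h2⟩
    rw [← hP]
    refine (mk_eq_chart hv (c := v 0) ?_).symm
    ext i; fin_cases i <;> simp [chartVec, mul_div_cancel₀ _ h1]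

/-- Which of the two charts is used at `P`. -/
noncomputable def chartIndex (P : P1 p) : Bool := (exists_chart P).choose

/-- The coordinate of `P` in its chart. -/
noncomputable def coord (P : P1 p) : ℤ_[p] := (exists_chart P).choose_spec.choose

theorem chart_coord (P : P1 p) : chart (chartIndex P) (coord P) = P :=
  (exists_chart P).choose_spec.choose_spec.1

theorem norm_coord_lt_one {P : P1 p} (h : chartIndex P = true) : ‖coord P‖ < 1 :=
  (exists_chart P).choose_spec.choose_spec.2 h

theorem dist_eq_norm_coord_sub {P Q : P1 p} (h : chartIndex P = chartIndex Q) :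
    dist P Q = ‖coord P - coord Q‖ := by
  conv_lhs => rw [← chart_coord P, ← chart_coord Q, h]
  exact dist_chart _ _ _

theorem dist_eq_one_of_chartIndex_ne {P Q : P1 p} (h : chartIndex P ≠ chartIndex Q) :
    dist P Q = 1 := by
  rw [← chart_coord P, ← chart_coord Q]
  exact dist_chart_of_ne h norm_coord_lt_one norm_coord_lt_one

theorem chartIndex_chart {b : Bool} {z : ℤ_[p]} (hz : b = true → ‖z‖ < 1) :
    chartIndex (chart b z) = b := by
  by_contra h
  have := dist_chart_of_ne h norm_coord_lt_one hz
  rw [chart_coord, dist_self] at this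
  exact zero_ne_one this

theorem coord_chart {b : Bool} {z : ℤ_[p]} (hz : b = true → ‖z‖ < 1) :
    coord (chart b z) = z := by
  have h := dist_chart b (coord (chart b z)) z
  have h1 := chart_coord (chart b z)
  rw [chartIndex_chart hz] at h1
  rw [h1, dist_self] at h
  exact sub_eq_zero.1 (norm_eq_zero.1 h.symm)

theorem dist_le_one (P Q : P1 p) : dist P Q ≤ 1 := by
  by_cases h : chartIndex P = chartIndex Q
  · rw [dist_eq_norm_coord_sub h]; exact PadicInt.norm_le_one _
  · exact (dist_eq_one_of_chartIndex_ne h).le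

theorem norm_le_inv_pow_iff_dvd (z : ℤ_[p]) (n : ℕ) :
    ‖z‖ ≤ ((p : ℝ) ^ n)⁻¹ ↔ (p : ℤ_[p]) ^ n ∣ z := by
  rw [← Ideal.mem_span_singleton, ← PadicInt.norm_le_pow_iff_mem_span_pow, zpow_neg,
    zpow_natCast]

theorem inv_pow_lt_one {n : ℕ} (hn : 1 ≤ n) : ((p : ℝ) ^ n)⁻¹ < 1 :=
  inv_lt_one_of_one_lt₀ (one_lt_pow₀ (by exact_mod_cast hp.out.one_lt) (by omega))

theorem dist_le_inv_pow_iff {P Q : P1 p} {n : ℕ} (hn : 1 ≤ n) :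
    dist P Q ≤ ((p : ℝ) ^ n)⁻¹ ↔
      chartIndex P = chartIndex Q ∧ (p : ℤ_[p]) ^ n ∣ coord P - coord Q := by
  by_cases h : chartIndex P = chartIndex Q
  · rw [dist_eq_norm_coord_sub h, norm_le_inv_pow_iff_dvd, and_iff_right h]
  · rw [dist_eq_one_of_chartIndex_ne h]
    exact iff_of_false (not_le.2 (inv_pow_lt_one hn)) fun h' => h h'.1

theorem norm_eq_inv_pow {z : ℤ_[p]} (hz : z ≠ 0) : ‖z‖ = ((p : ℝ) ^ z.valuation)⁻¹ := by
  rw [PadicInt.norm_eq_zpow_neg_valuation hz, zpow_neg, zpow_natCast]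

theorem eq_or_dist_eq_one_or_inv_pow (P Q : P1 p) :
    P = Q ∨ dist P Q = 1 ∨ ∃ n, 1 ≤ n ∧ dist P Q = ((p : ℝ) ^ n)⁻¹ := by
  by_cases hPQ : P = Q
  · exact Or.inl hPQ
  right
  by_cases h : chartIndex P = chartIndex Q
  · have h0 : coord P - coord Q ≠ 0 := by
      intro h0
      apply hPQ
      rw [← dist_eq_zero, dist_eq_norm_coord_sub h, h0, norm_zero]
    rw [dist_eq_norm_coord_sub h, norm_eq_inv_pow h0]
    rcases Nat.eq_zero_or_pos (coord P - coord Q).valuation with h1 | h1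
    · left; simp [h1]
    · exact Or.inr ⟨_, h1, rfl⟩
  · exact Or.inl (dist_eq_one_of_chartIndex_ne h)

instance : CompactSpace (P1 p) := by
  have hiso : ∀ b, Isometry (chart (p := p) b) := fun b =>
    Isometry.of_dist_eq fun z w => by rw [dist_chart, dist_eq_norm]
  rw [← isCompact_univ_iff]
  convert (isCompact_range (hiso false).continuous).union (isCompact_range (hiso true).continuous)
  refine (Set.eq_univ_of_forall fun P => ?_).symm
  rw [← chart_coord P]
  cases chartIndex P
  · exact Or.inl ⟨_, rfl⟩
  · exact Or.inr ⟨_, rfl⟩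

/-- There are points at distance exactly `p⁻ⁿ` from any given point. -/
theorem exists_dist_eq_inv_pow (P : P1 p) (n : ℕ) :
    ∃ Q : P1 p, dist Q P = ((p : ℝ) ^ n)⁻¹ := by
  refine ⟨chart (chartIndex P) (coord P + (p : ℤ_[p]) ^ n), ?_⟩
  conv_lhs => rw [← chart_coord P, chartIndex_chart norm_coord_lt_one,
    coord_chart norm_coord_lt_one, dist_chart]
  simp

/-- The residue class of a point in `ℙ¹(𝔽_p)`, with `none` for the point at infinity. -/
noncomputable def residue (P : P1 p) : Option (ZMod p) :=
  bif chartIndex P then none else some (PadicInt.toZMod (coord P))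

theorem toZMod_eq_zero_iff_dvd (z : ℤ_[p]) : PadicInt.toZMod z = 0 ↔ (p : ℤ_[p]) ∣ z := by
  rw [← RingHom.mem_ker, PadicInt.ker_toZMod, PadicInt.maximalIdeal_eq_span_p,
    Ideal.mem_span_singleton]

theorem dist_le_of_residue_eq {P Q : P1 p} (h : residue P = residue Q) :
    dist P Q ≤ ((p : ℝ) ^ 1)⁻¹ := by
  rw [dist_le_inv_pow_iff le_rfl, pow_one]
  unfold residue at h
  cases hP : chartIndex P <;> cases hQ : chartIndex Q <;> simp only [hP, hQ, cond_true,
    cond_false, reduceCtorEq, Option.some.injEq] at h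
  · exact ⟨rfl, by rw [← toZMod_eq_zero_iff_dvd, map_sub, h, sub_self]⟩
  · refine ⟨rfl, dvd_sub ?_ ?_⟩
    · exact PadicInt.norm_lt_one_iff_dvd _ |>.1 (norm_coord_lt_one hP)
    · exact PadicInt.norm_lt_one_iff_dvd _ |>.1 (norm_coord_lt_one hQ)

end Charts

/-! ### Integral lifts of a rational map with good reduction -/

section Lift

variable {K : Type*} [Field K]

theorem exists_common_factor (f : K[X]) {g : K[X]} (hg : g ≠ 0) {φ : RatFunc K}
    (hφ : φ = algebraMap K[X] (RatFunc K) f / algebraMap K[X] (RatFunc K) g) :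
    ∃ h : K[X], h ≠ 0 ∧ f = h * φ.num ∧ g = h * φ.denom := by
  obtain ⟨h, hh⟩ : φ.denom ∣ g := hφ ▸ RatFunc.denom_div_dvd f g
  refine ⟨h, ?_, ?_, by rw [hh, mul_comm]⟩
  · rintro rfl; exact hg (by simpa using hh)
  · have h1 := (RatFunc.num_mul_eq_mul_denom_iff hg).2 hφ
    refine mul_right_cancel₀ φ.denom_ne_zero ?_
    rw [← h1, hh]; ring

theorem homEval_C_mul (c : K) (f : K[X]) (d : ℕ) (v : Fin 2 → K) :
    homEval (C c * f) d v = c * homEval f d v := by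
  simp only [homEval, coeff_C_mul, Finset.mul_sum, mul_assoc]

/-- The polynomial describing the homogenization of degree `d` of `f` in a standard chart. -/
noncomputable def chartPoly {R : Type*} [Semiring R] (b : Bool) (d : ℕ) (f : R[X]) : R[X] :=
  ∑ i ∈ Finset.range (d + 1), C (f.coeff i) * X ^ (bif b then d - i else i)

theorem homEval_map_chartVec {R : Type*} [CommRing R] (σ : R →+* K) (b : Bool) (d : ℕ) (f : R[X])
    (z : R) : homEval (f.map σ) d (chartVec b (σ z)) = σ ((chartPoly b d f).eval z) := by
  simp only [homEval, chartPoly, eval_finsetSum, map_sum, coeff_map]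
  refine Finset.sum_congr rfl fun i _ => ?_
  cases b <;> simp [chartVec]

/-- A common factor of positive degree would push the numerator or denominator above the degree of
`φ`. Applied to the reduction, this says that no cancellation occurs. -/
theorem exists_common_factor_C {f g : K[X]} (hg : g ≠ 0) {φ : RatFunc K} (hd : 0 < ratDegree φ)
    (hφ : φ = algebraMap K[X] (RatFunc K) f / algebraMap K[X] (RatFunc K) g)
    (hf : f.natDegree ≤ ratDegree φ) (hg' : g.natDegree ≤ ratDegree φ) :
    ∃ c : K, c ≠ 0 ∧ f = C c * φ.num ∧ g = C c * φ.denom := by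
  obtain ⟨h, h0, hhf, hhg⟩ := exists_common_factor f hg hφ
  have hh : h.natDegree = 0 := by
    rcases max_choice φ.num.natDegree φ.denom.natDegree with hm | hm
    · have hn : φ.num ≠ 0 := by
        intro hn
        rw [ratDegree, hm, hn, natDegree_zero] at hd
        exact lt_irrefl _ hd
      rw [ratDegree, hm, hhf, natDegree_mul h0 hn] at hf
      omega
    · rw [ratDegree, hm, hhg, natDegree_mul h0 φ.denom_ne_zero] at hg'
      omega
  rw [eq_C_of_natDegree_eq_zero hh] at hhf hhg h0
  exact ⟨_, fun hc => h0 (by rw [hc, C_0]), hhf, hhg⟩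

theorem ratDegree_eq_of_isCoprime {f g : K[X]} (hg : g ≠ 0) (hfg : IsCoprime f g) {φ : RatFunc K}
    (hφ : φ = algebraMap K[X] (RatFunc K) f / algebraMap K[X] (RatFunc K) g) :
    ratDegree φ = max f.natDegree g.natDegree := by
  obtain ⟨h, h0, hhf, hhg⟩ := exists_common_factor f hg hφ
  have hu : IsUnit h := hfg.isUnit_of_dvd' ⟨_, hhf⟩ ⟨_, hhg⟩
  obtain ⟨c, hc, rfl⟩ := isUnit_iff.1 hu
  rw [hhf, hhg, natDegree_C_mul hc.ne_zero, natDegree_C_mul hc.ne_zero, ratDegree]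

end Lift

section GoodReduction

variable {p : ℕ} [hp : Fact p.Prime] {φ : RatFunc ℚ_[p]}

theorem norm_eq_one_iff_toZMod_ne_zero (z : ℤ_[p]) : ‖z‖ = 1 ↔ PadicInt.toZMod z ≠ 0 := by
  rw [Ne, toZMod_eq_zero_iff_dvd, ← PadicInt.norm_lt_one_iff_dvd, not_lt]
  exact ⟨fun h => h.ge, fun h => le_antisymm (PadicInt.norm_le_one z) h⟩

/-- In the standard charts, a map with good reduction is given by pairs of integral polynomials
without common zero modulo `p`. -/
theorem exists_chart_lift (hdeg : 2 ≤ ratDegree φ) (hred : HasGoodReduction φ) :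
    ∃ F G : Bool → ℤ_[p][X], ∀ b z,
      (‖(F b).eval z‖ = 1 ∨ ‖(G b).eval z‖ = 1) ∧
      (∀ u, ‖(G b).eval z‖ = 1 → u * (G b).eval z = (F b).eval z →
        ratMap φ (chart b z) = chart false u) ∧
      (∀ u, ‖(F b).eval z‖ = 1 → u * (F b).eval z = (G b).eval z →
        ratMap φ (chart b z) = chart true u) := by
  obtain ⟨f, g, hg, hfg, -, hφ, hd⟩ := hred
  have hinj : Function.Injective (PadicInt.Coe.ringHom (p := p)) := Subtype.val_injective
  have hg' : g.map PadicInt.Coe.ringHom ≠ 0 := (Polynomial.map_ne_zero_iff hinj).2 hg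
  have hdφ := ratDegree_eq_of_isCoprime hg' hfg hφ
  rw [natDegree_map_eq_of_injective hinj, natDegree_map_eq_of_injective hinj] at hdφ
  have hfd : f.natDegree ≤ ratDegree φ := hdφ ▸ le_max_left _ _
  have hgd : g.natDegree ≤ ratDegree φ := hdφ ▸ le_max_right _ _
  obtain ⟨c, hc, hcf, hcg⟩ := exists_common_factor_C hg' (by omega) hφ
    (natDegree_map_le.trans hfd) (natDegree_map_le.trans hgd)
  -- If the reduced denominator vanished, the quotient would be `0`, of degree `0` rather than at
  -- least `2`.
  have hgbar : g.map PadicInt.toZMod ≠ 0 := by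
    intro h0
    rw [h0, map_zero, div_zero, ratDegree, RatFunc.num_zero, RatFunc.denom_zero, natDegree_zero,
      natDegree_one] at hd
    omega
  set ψ := algebraMap (ZMod p)[X] (RatFunc (ZMod p)) (f.map PadicInt.toZMod) /
        algebraMap (ZMod p)[X] (RatFunc (ZMod p)) (g.map PadicInt.toZMod) with hψ
  obtain ⟨e, he, hef, heg⟩ := exists_common_factor_C hgbar (by omega) hψ
    (natDegree_map_le.trans (hd ▸ hfd)) (natDegree_map_le.trans (hd ▸ hgd))
  set d := ratDegree φ with hdd
  refine ⟨fun b => chartPoly b d f, fun b => chartPoly b d g, fun b z => ?_⟩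
  have hF : (((chartPoly b d f).eval z : ℤ_[p]) : ℚ_[p]) =
      c * homEval φ.num d (chartVec b (z : ℚ_[p])) := by
    rw [← homEval_C_mul, ← hcf]
    exact (homEval_map_chartVec PadicInt.Coe.ringHom b d f z).symm
  have hG : (((chartPoly b d g).eval z : ℤ_[p]) : ℚ_[p]) =
      c * homEval φ.denom d (chartVec b (z : ℚ_[p])) := by
    rw [← homEval_C_mul, ← hcg]
    exact (homEval_map_chartVec PadicInt.Coe.ringHom b d g z).symm
  have hmap : ∀ b' (u : ℤ_[p]), (∃ a : ℚ_[p], a • chartVec b' (u : ℚ_[p]) =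
      ![(((chartPoly b d f).eval z : ℤ_[p]) : ℚ_[p]),
        (((chartPoly b d g).eval z : ℤ_[p]) : ℚ_[p])]) →
      ratMap φ (chart b z) = chart b' u := by
    rintro b' u ⟨a, ha⟩
    change Projectivization.mk _ (homLift φ (chartVec b (z : ℚ_[p]))) _ = _
    refine mk_eq_chart _ (c := c⁻¹ * a) ?_
    rw [mul_smul, ha, hF, hG]
    ext i
    fin_cases i <;> simp [homLift, hc, ← hdd]
  refine ⟨?_, fun u _ hu => hmap _ _ ⟨((chartPoly b d g).eval z : ℤ_[p]), ?_⟩,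
    fun u _ hu => hmap _ _ ⟨((chartPoly b d f).eval z : ℤ_[p]), ?_⟩⟩
  -- A common zero modulo `p` would be a common zero of the homogeneous lift of the reduction `ψ`.
  · rw [norm_eq_one_iff_toZMod_ne_zero, norm_eq_one_iff_toZMod_ne_zero,
      ← homEval_map_chartVec, ← homEval_map_chartVec, hef, heg, homEval_C_mul, homEval_C_mul]
    by_contra! h
    refine homLift_ne_zero ψ (chartVec_ne_zero b (PadicInt.toZMod z)) ?_
    ext i
    fin_cases i
    · simpa [homLift, he, hd] using h.1
    · simpa [homLift, he, hd] using h.2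
  · rw [← hu]
    ext i; fin_cases i <;> simp [chartVec, mul_comm]
  · rw [← hu]
    ext i; fin_cases i <;> simp [chartVec, mul_comm]

/-! ### Local behaviour of a map with good reduction -/

theorem exists_mul_eq_of_norm_eq_one (x : ℤ_[p]) {y : ℤ_[p]} (hy : ‖y‖ = 1) : ∃ u, u * y = x := by
  obtain ⟨y, rfl⟩ := PadicInt.isUnit_iff.2 hy
  exact ⟨x * ↑y⁻¹, by simp⟩

/-- A quotient of integral polynomials is affine to first order near a point where the denominator
is a unit. -/
theorem exists_linear_approx_quotient (F G : ℤ_[p][X]) (z : ℤ_[p]) (hG : ‖G.eval z‖ = 1) :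
    ∃ m : ℤ_[p], ∀ n, 1 ≤ n → ∀ z' u u', (p : ℤ_[p]) ^ n ∣ z' - z → u * G.eval z = F.eval z →
      u' * G.eval z' = F.eval z' → (p : ℤ_[p]) ^ (n + 1) ∣ u' - u - m * (z' - z) := by
  obtain ⟨γ, hγ⟩ := exists_mul_eq_of_norm_eq_one 1 hG
  obtain ⟨u₀, hu₀⟩ := exists_mul_eq_of_norm_eq_one (F.eval z) hG
  -- This is the quotient rule for `F / G` at `z`, with `γ = 1 / G(z)` and `u₀ = F(z) / G(z)`.
  refine ⟨γ * (F.derivative.eval z - u₀ * G.derivative.eval z),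
    fun n hn z' u u' hz hu hu' => ?_⟩
  obtain rfl : u = u₀ := by linear_combination γ * hu - γ * hu₀ - (u - u₀) * hγ
  obtain ⟨kF, hkF⟩ := F.binomExpansion z (z' - z)
  obtain ⟨kG, hkG⟩ := G.binomExpansion z (z' - z)
  rw [add_sub_cancel] at hkF hkG
  have hpz : (p : ℤ_[p]) ∣ z' - z := (dvd_pow_self _ (by omega)).trans hz
  have h1 : (p : ℤ_[p]) ∣ u' - u := by
    have : u' - u = γ * (z' - z) * (F.derivative.eval z + kF * (z' - z)
        - u' * (G.derivative.eval z + kG * (z' - z))) := by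
      linear_combination γ * hu' - γ * hu + γ * hkF - γ * u' * hkG - (u' - u) * hγ
    rw [this]
    exact Dvd.dvd.mul_right (hpz.mul_left _) _
  -- The error is `z' - z` times a combination of `z' - z` and `u' - u`, both divisible by `p`,
  -- which supplies the extra factor.
  have h2 : u' - u - γ * (F.derivative.eval z - u * G.derivative.eval z) * (z' - z)
      = (z' - z) * (γ * (kF - u' * kG) * (z' - z) - γ * G.derivative.eval z * (u' - u)) := by
    linear_combination γ * hu' - γ * hu + γ * hkF - γ * u' * hkG - (u' - u) * hγ
  rw [h2, pow_succ]
  exact mul_dvd_mul hz (dvd_sub (hpz.mul_left _) (h1.mul_left _))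

theorem norm_eval_eq_one_of_dvd (F : ℤ_[p][X]) {z z' : ℤ_[p]} (h : (p : ℤ_[p]) ∣ z' - z) :
    ‖F.eval z'‖ = 1 ↔ ‖F.eval z‖ = 1 := by
  rw [norm_eq_one_iff_toZMod_ne_zero, norm_eq_one_iff_toZMod_ne_zero,
    show PadicInt.toZMod (F.eval z') = PadicInt.toZMod (F.eval z) from ?_]
  rw [← sub_eq_zero, ← map_sub, toZMod_eq_zero_iff_dvd]
  exact h.trans (sub_dvd_eval_sub _ _ _)

/-- On each residue disc, a map with good reduction is affine to first order. -/
theorem exists_multiplier (hdeg : 2 ≤ ratDegree φ) (hred : HasGoodReduction φ) (P : P1 p) :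
    ∃ m : ℤ_[p], ∀ n, 1 ≤ n → ∀ Q : P1 p, dist Q P ≤ ((p : ℝ) ^ n)⁻¹ →
      dist (ratMap φ Q) (ratMap φ P) ≤ ((p : ℝ) ^ n)⁻¹ ∧
      (p : ℤ_[p]) ^ (n + 1) ∣
        coord (ratMap φ Q) - coord (ratMap φ P) - m * (coord Q - coord P) := by
  obtain ⟨F, G, hFG⟩ := exists_chart_lift hdeg hred
  -- it suffices to find a chart of the target in which the map is a quotient of polynomials
  have key : ∀ (b : Bool) (A B : ℤ_[p][X]), ‖B.eval (coord P)‖ = 1 →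
      (∀ z, (p : ℤ_[p]) ∣ z - coord P → ∃ u, u * B.eval z = A.eval z ∧ (b = true → ‖u‖ < 1) ∧
        ratMap φ (chart (chartIndex P) z) = chart b u) →
      ∃ m : ℤ_[p], ∀ n, 1 ≤ n → ∀ Q : P1 p, dist Q P ≤ ((p : ℝ) ^ n)⁻¹ →
        dist (ratMap φ Q) (ratMap φ P) ≤ ((p : ℝ) ^ n)⁻¹ ∧
        (p : ℤ_[p]) ^ (n + 1) ∣
          coord (ratMap φ Q) - coord (ratMap φ P) - m * (coord Q - coord P) := by
    intro b A B hB h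
    obtain ⟨m, hm⟩ := exists_linear_approx_quotient A B (coord P) hB
    refine ⟨m, fun n hn Q hQ => ?_⟩
    obtain ⟨hidx, hdvd⟩ := (dist_le_inv_pow_iff hn).1 hQ
    obtain ⟨u, hu, hub, hPu⟩ := h (coord P) (by simp)
    obtain ⟨u', hu', hub', hQu⟩ := h (coord Q) ((dvd_pow_self _ (by omega)).trans hdvd)
    rw [chart_coord] at hPu
    rw [← hidx, chart_coord] at hQu
    have h1 := hm n hn _ u u' hdvd hu hu'
    rw [dist_le_inv_pow_iff hn, hPu, hQu, chartIndex_chart hub, chartIndex_chart hub',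
      coord_chart hub, coord_chart hub']
    refine ⟨⟨rfl, ?_⟩, h1⟩
    rw [← sub_add_cancel (u' - u) (m * (coord Q - coord P))]
    exact dvd_add ((pow_dvd_pow _ n.le_succ).trans h1) (hdvd.mul_left _)
  set b := chartIndex P
  by_cases hG : ‖(G b).eval (coord P)‖ = 1
  · refine key false (F b) (G b) hG fun z hz => ?_
    have hGz := (norm_eval_eq_one_of_dvd (G b) hz).2 hG
    obtain ⟨u, hu⟩ := exists_mul_eq_of_norm_eq_one ((F b).eval z) hGz
    exact ⟨u, hu, by simp, (hFG b z).2.1 u hGz hu⟩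
  · have hF : ‖(F b).eval (coord P)‖ = 1 := (hFG b (coord P)).1.resolve_right hG
    refine key true (G b) (F b) hF fun z hz => ?_
    have hFz := (norm_eval_eq_one_of_dvd (F b) hz).2 hF
    have hGz : ‖(G b).eval z‖ < 1 := lt_of_le_of_ne (PadicInt.norm_le_one _)
      fun h => hG ((norm_eval_eq_one_of_dvd (G b) hz).1 h)
    obtain ⟨u, hu⟩ := exists_mul_eq_of_norm_eq_one ((G b).eval z) hFz
    refine ⟨u, hu, fun _ => ?_, (hFG b z).2.2 u hFz hu⟩
    rwa [← hu, norm_mul, hFz, mul_one] at hGz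

theorem dist_ratMap_le (hdeg : 2 ≤ ratDegree φ) (hred : HasGoodReduction φ) (P Q : P1 p) :
    dist (ratMap φ P) (ratMap φ Q) ≤ dist P Q := by
  rcases eq_or_dist_eq_one_or_inv_pow P Q with rfl | h | ⟨n, hn, h⟩
  · simp
  · rw [h]; exact dist_le_one _ _
  · obtain ⟨m, hm⟩ := exists_multiplier hdeg hred Q
    rw [h]; exact (hm n hn P h.le).1

end GoodReduction

/-! ### Multipliers along an orbit -/

section Multipliers

variable {p : ℕ} [hp : Fact p.Prime]

/-- `M P` is a derivative modulo `p` of `T` at `P`, in the charts at `P` and `T P`. -/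
def IsMultiplier (T : P1 p → P1 p) (M : P1 p → ℤ_[p]) : Prop :=
  ∀ P n, 1 ≤ n → ∀ Q, dist Q P ≤ ((p : ℝ) ^ n)⁻¹ →
    (p : ℤ_[p]) ^ (n + 1) ∣ coord (T Q) - coord (T P) - M P * (coord Q - coord P)

variable {T : P1 p → P1 p} {M : P1 p → ℤ_[p]}

theorem IsMultiplier.iterate (hT : ∀ P Q, dist (T P) (T Q) ≤ dist P Q) (hM : IsMultiplier T M)
    (j : ℕ) : IsMultiplier T^[j] fun P => ∏ i ∈ Finset.range j, M (T^[i] P) := by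
  intro P n hn Q hQ
  beta_reduce
  induction j with
  | zero => simp
  | succ j ih =>
    have h1 := hM (T^[j] P) n hn (T^[j] Q) ((dist_iterate_le hT _ _ _).trans hQ)
    have h2 := dvd_add h1 (ih.mul_left (M (T^[j] P)))
    rw [Function.iterate_succ_apply', Function.iterate_succ_apply', Finset.prod_range_succ]
    convert h2 using 1
    ring

/-- Adding the expansions at `P` and at `Q` shows that `(M Q - M P) * (coord Q - coord P)` is
divisible by one more power of `p` than the second factor, so the first is not a unit. -/
theorem IsMultiplier.toZMod_eq (hM : IsMultiplier T M) {P Q : P1 p}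
    (hPQ : dist Q P ≤ ((p : ℝ) ^ 1)⁻¹) : PadicInt.toZMod (M Q) = PadicInt.toZMod (M P) := by
  rcases eq_or_dist_eq_one_or_inv_pow Q P with rfl | h | ⟨n, hn, h⟩
  · rfl
  · exact absurd (h ▸ hPQ) (not_le.2 (inv_pow_lt_one le_rfl))
  by_contra hne
  have h1 := hM P n hn Q h.le
  have h2 := hM Q n hn P (by rw [dist_comm, h])
  have h3 : (p : ℤ_[p]) ^ (n + 1) ∣ (M Q - M P) * (coord Q - coord P) := by
    convert dvd_add h1 h2 using 1
    ring
  have hu : IsUnit (M Q - M P) := by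
    rw [PadicInt.isUnit_iff, norm_eq_one_iff_toZMod_ne_zero, map_sub]
    exact sub_ne_zero.2 hne
  rw [hu.dvd_mul_left] at h3
  have h4 := (dist_le_inv_pow_iff (Nat.le_add_left 1 n)).2
    ⟨((dist_le_inv_pow_iff hn).1 h.le).1, h3⟩
  have hp1 : (1 : ℝ) < p := by exact_mod_cast hp.out.one_lt
  rw [h, inv_le_inv₀ (by positivity) (by positivity)] at h4
  exact absurd h4 (not_le.2 (pow_lt_pow_right₀ hp1 n.lt_succ_self))

/-- The product splits into `q` blocks of length `s`, each starting in the residue disc of `P`,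
where the multiplier of `T^[s]` is constant modulo `p`. -/
theorem IsMultiplier.toZMod_prod_mul (hT : ∀ P Q, dist (T P) (T Q) ≤ dist P Q)
    (hM : IsMultiplier T M) {P : P1 p} {s : ℕ}
    (hs : ∀ q, dist (T^[s * q] P) P ≤ ((p : ℝ) ^ 1)⁻¹) (q : ℕ) :
    PadicInt.toZMod (∏ i ∈ Finset.range (s * q), M (T^[i] P)) =
      PadicInt.toZMod (∏ i ∈ Finset.range s, M (T^[i] P)) ^ q := by
  induction q with
  | zero => simp
  | succ q ih =>
    have h := (hM.iterate hT s).toZMod_eq (hs q)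
    simp only [← Function.iterate_add_apply] at h
    rw [mul_add, mul_one, Finset.prod_range_add, map_mul, ih, pow_succ, ← h]
    simp only [add_comm (s * q)]

/-- At the next level, the returns to a ball follow the orbit of `0` under an affine map of
`ZMod p` whose linear part is the multiplier. -/
theorem IsMultiplier.exists_translation (hT : ∀ P Q, dist (T P) (T Q) ≤ dist P Q)
    (hM : IsMultiplier T M) {P : P1 p} {n : ℕ} (hn : 1 ≤ n)
    (hP : dist (T P) P ≤ ((p : ℝ) ^ n)⁻¹) :
    ∃ a : ZMod p, ∀ j, dist (T^[j] P) P ≤ ((p : ℝ) ^ (n + 1))⁻¹ ↔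
      a * ∑ i ∈ Finset.range j, PadicInt.toZMod (M P) ^ i = 0 := by
  have hclose : ∀ j, dist (T^[j] P) P ≤ ((p : ℝ) ^ n)⁻¹ := by
    intro j
    induction j with
    | zero => simp
    | succ j ih =>
      rw [Function.iterate_succ_apply']
      exact (dist_triangle_max _ (T P) _).trans (max_le ((hT _ _).trans ih) hP)
  obtain ⟨-, A, hA⟩ := (dist_le_inv_pow_iff hn).1 hP
  -- Writing `coord (T P) = coord P + p^n A`, the `n`-th digit evolves by `y ↦ M P * y + A` modulo
  -- `p`, starting at `0`.
  have hsum : ∀ j, (p : ℤ_[p]) ^ (n + 1) ∣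
      coord (T^[j] P) - coord P - (p : ℤ_[p]) ^ n * (A * ∑ i ∈ Finset.range j, M P ^ i) := by
    intro j
    induction j with
    | zero => simp
    | succ j ih =>
      have h1 := dvd_add (hM P n hn _ (hclose j)) (ih.mul_left (M P))
      rw [Function.iterate_succ_apply', geom_sum_succ]
      convert h1 using 1
      linear_combination hA
  refine ⟨PadicInt.toZMod A, fun j => ?_⟩
  rw [dist_le_inv_pow_iff (Nat.le_add_left 1 n),
    and_iff_right ((dist_le_inv_pow_iff hn).1 (hclose j)).1, (dvd_iff_dvd_of_dvd_sub (hsum j)),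
    pow_succ, mul_dvd_mul_iff_left (pow_ne_zero _ (by exact_mod_cast hp.out.ne_zero)),
    ← toZMod_eq_zero_iff_dvd]
  simp only [map_mul, map_sum, map_pow]

/-- The return times of a 1-Lipschitz map with multipliers are cofinal with one of the sequences
`(k, kℓ, kℓp, …)`, as soon as the closure of the orbit is a neighbourhood of the point. -/
theorem IsMultiplier.exists_structureSeq (hT : ∀ P Q, dist (T P) (T Q) ≤ dist P Q)
    (hM : IsMultiplier T M) {P : P1 p} {s : ℕ → ℕ} (hs0 : ∀ n, 0 < s n)
    (hs : ∀ n a b, dist (T^[a] P) (T^[b] P) ≤ ((p : ℝ) ^ n)⁻¹ ↔ a ≡ b [MOD s n])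
    (hP : closure (Set.range fun n : ℕ => T^[n] P) ∈ nhds P) :
    ∃ k l, 1 ≤ k ∧ k ≤ p + 1 ∧ l ∣ p - 1 ∧ (∀ n, ∃ m, structureSeq p k l n ∣ s m) ∧
      ∀ m, ∃ n, s m ∣ structureSeq p k l n := by
  have hp1 : (1 : ℝ) < p := by exact_mod_cast hp.out.one_lt
  have hanti : ∀ {m n : ℕ}, m ≤ n → ((p : ℝ) ^ n)⁻¹ ≤ ((p : ℝ) ^ m)⁻¹ := fun {m n} h =>
    inv_anti₀ (by positivity) (pow_le_pow_right₀ hp1.le h)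
  have hret : ∀ n a, dist (T^[a] P) P ≤ ((p : ℝ) ^ n)⁻¹ ↔ s n ∣ a := fun n a =>
    (hs n a 0).trans Nat.modEq_zero_iff_dvd
  have hmono : ∀ {m n}, m ≤ n → s m ∣ s n := fun {m n} h =>
    (hret m _).1 (((hret n _).2 dvd_rfl).trans (hanti h))
  -- The first `s 1` orbit points lie in distinct residue discs, of which there are `p + 1`.
  have hk : s 1 ≤ p + 1 := by
    have hinj : Function.Injective fun i : Fin (s 1) => residue (T^[i] P) := fun i j hij => by
      have h := (hs 1 _ _).1 (dist_le_of_residue_eq hij)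
      exact Fin.ext (h.eq_of_lt_of_lt i.2 j.2)
    simpa [ZMod.card] using Fintype.card_le_of_injective _ hinj
  set β := PadicInt.toZMod (∏ i ∈ Finset.range (s 1), M (T^[i] P))
  have hβ : ∀ n, 1 ≤ n →
      PadicInt.toZMod (∏ i ∈ Finset.range (s n), M (T^[i] P)) = β ^ (s n / s 1) := by
    intro n hn
    rw [← hM.toZMod_prod_mul hT (fun q => (hret 1 _).2 (dvd_mul_right _ _)),
      Nat.mul_div_cancel' (hmono hn)]
  have ha : ∀ n, ∃ a : ZMod p, 1 ≤ n → ∀ j, s (n + 1) ∣ s n * j ↔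
      a * ∑ i ∈ Finset.range j, (β ^ (s n / s 1)) ^ i = 0 := by
    intro n
    by_cases hn : 1 ≤ n
    · obtain ⟨a, ha⟩ := (hM.iterate hT (s n)).exists_translation (dist_iterate_le hT (s n)) hn
        ((hret n _).2 dvd_rfl)
      refine ⟨a, fun _ j => ?_⟩
      rw [← hβ n hn, ← ha j, ← Function.iterate_mul, hret]
    · exact ⟨0, fun h => absurd h hn⟩
  choose a ha using ha
  -- If `s (n+1) = s n`, orbit points within `p⁻ⁿ` of `P` are within `p⁻⁽ⁿ⁺¹⁾`, so no point at
  -- distance exactly `p⁻ⁿ` is a limit of the orbit; but for large `n` such points lie in its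
  -- closure.
  have hgrow : ∃ N, ∀ n, N ≤ n → s (n + 1) ≠ s n := by
    obtain ⟨ε, hε, hball⟩ := Metric.mem_nhds_iff.1 hP
    obtain ⟨N, hN⟩ := exists_pow_lt_of_lt_one hε (inv_lt_one_of_one_lt₀ hp1)
    rw [inv_pow] at hN
    refine ⟨N, fun n hn heq => ?_⟩
    obtain ⟨Q, hQ⟩ := exists_dist_eq_inv_pow P n
    have hQ' : Q ∈ Metric.ball P ε := by
      rw [Metric.mem_ball, hQ]; exact (hanti hn).trans_lt hN
    obtain ⟨_, ⟨m, rfl⟩, hm⟩ := Metric.mem_closure_iff.1 (hball hQ') ((p : ℝ) ^ (n + 1))⁻¹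
      (by positivity)
    have h1 : dist (T^[m] P) P ≤ ((p : ℝ) ^ n)⁻¹ :=
      (dist_triangle_max _ Q _).trans
        (max_le (by rw [dist_comm]; exact hm.le.trans (hanti n.le_succ)) hQ.le)
    rw [hret, ← heq, ← hret] at h1
    have h2 := (dist_triangle_max Q (T^[m] P) P).trans (max_le hm.le h1)
    rw [hQ, inv_le_inv₀ (by positivity) (by positivity)] at h2
    exact absurd h2 (not_le.2 (pow_lt_pow_right₀ hp1 n.lt_succ_self))
  obtain ⟨l, hl, h1, h2⟩ :=
    exists_structureSeq_cofinal hs0 (fun n => hmono n.le_succ) β a ha hgrow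
  exact ⟨s 1, l, hs0 1, hk, hl, h1, h2⟩

end Multipliers

end PadicGoodReduction

/-! ### Restriction to the minimal component and conclusion -/

open PadicGoodReduction in
theorem theorem1p3 (p : ℕ) [Fact p.Prime] (φ : RatFunc ℚ_[p])
    (hdeg : 2 ≤ PadicGoodReduction.ratDegree φ)
    (hred : PadicGoodReduction.HasGoodReduction φ)
    (E : Set (PadicGoodReduction.P1 p))
    (hE : PadicGoodReduction.IsMinimalComponent φ E) :
    ∃ k l : ℕ, 1 ≤ k ∧ k ≤ p + 1 ∧ l ∣ p - 1 ∧
      PadicGoodReduction.TopConjugate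
        (hE.mapsTo.restrict (PadicGoodReduction.ratMap φ) E E)
        (PadicGoodReduction.addingMachine (PadicGoodReduction.structureSeq p k l)
          (PadicGoodReduction.structureSeq_dvd p k l)) := by
  have hp1 : (1 : ℝ) < p := by exact_mod_cast (Fact.out : p.Prime).one_lt
  have hT := dist_ratMap_le hdeg hred
  choose M hM using exists_multiplier hdeg hred
  have hM' : IsMultiplier (ratMap φ) M := fun P n hn Q hQ => (hM P n hn Q hQ).2
  obtain ⟨x₀, hx₀⟩ := hE.nonempty
  -- Density is used for the orbit of `φ x₀`, so that the return time `m + 1` is positive.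
  have hrec : ∀ n : ℕ, ∃ m, 0 < m ∧ dist ((ratMap φ)^[m] x₀) x₀ ≤ ((p : ℝ) ^ n)⁻¹ := fun n => by
    obtain ⟨_, ⟨m, rfl⟩, hm⟩ := Metric.mem_closure_iff.1
      (hE.dense_orbit _ (hE.mapsTo hx₀) hx₀) ((p : ℝ) ^ n)⁻¹ (by positivity)
    exact ⟨m + 1, m.succ_pos, by rw [dist_comm]; exact hm.le⟩
  have hret : ∀ n : ℕ, ∃ s, 0 < s ∧ ∀ a b,
      dist ((ratMap φ)^[a] x₀) ((ratMap φ)^[b] x₀) ≤ ((p : ℝ) ^ n)⁻¹ ↔ a ≡ b [MOD s] :=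
    fun n => exists_returnTime hT x₀ (by positivity) (hrec n)
  choose s hs0 hs using hret
  obtain ⟨k, l, hk, hkp, hl, h1, h2⟩ := hM'.exists_structureSeq hT hs0 hs
    (Filter.mem_of_superset (hE.isClopen.isOpen.mem_nhds hx₀) (hE.dense_orbit _ hx₀))
  refine ⟨k, l, hk, hkp, hl, ?_⟩
  have hcompact : CompactSpace E := isCompact_iff_compactSpace.1 hE.isClopen.isClosed.isCompact
  have hval : ∀ n (x : E),
      (((hE.mapsTo.restrict (ratMap φ) E E)^[n] x : E) : P1 p) = (ratMap φ)^[n] x := by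
    intro n x
    rw [hE.mapsTo.iterate_restrict]
    rfl
  have hdense : DenseRange fun n : ℕ => (hE.mapsTo.restrict (ratMap φ) E E)^[n] ⟨x₀, hx₀⟩ := by
    intro x
    rw [Metric.mem_closure_iff]
    intro δ hδ
    obtain ⟨_, ⟨m, rfl⟩, hm⟩ := Metric.mem_closure_iff.1 (hE.dense_orbit _ hx₀ x.2) δ hδ
    exact ⟨_, ⟨m, rfl⟩, by rwa [Subtype.dist_eq, hval]⟩
  have hanti : Antitone fun n : ℕ => ((p : ℝ) ^ n)⁻¹ := fun m n h =>
    inv_anti₀ (by positivity) (pow_le_pow_right₀ hp1.le h)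
  have hlim : ∀ δ > 0, ∃ n : ℕ, ((p : ℝ) ^ n)⁻¹ < δ := fun δ hδ => by
    obtain ⟨n, hn⟩ := exists_pow_lt_of_lt_one hδ (inv_lt_one_of_one_lt₀ hp1)
    exact ⟨n, by rwa [inv_pow] at hn⟩
  have hsE : ∀ n a b, dist ((hE.mapsTo.restrict (ratMap φ) E E)^[a] ⟨x₀, hx₀⟩)
      ((hE.mapsTo.restrict (ratMap φ) E E)^[b] ⟨x₀, hx₀⟩) ≤ ((p : ℝ) ^ n)⁻¹ ↔
        a ≡ b [MOD s n] := fun n a b => by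
    rw [Subtype.dist_eq, hval, hval]
    exact hs n a b
  have hTE : ∀ x y : E, dist (hE.mapsTo.restrict (ratMap φ) E E x)
      (hE.mapsTo.restrict (ratMap φ) E E y) ≤ dist x y := fun x y => hT x y
  exact topConjugate_addingMachine hTE hdense (fun n => by positivity) hanti hlim hs0 hsE _ _ h1 h2
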